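/- Consider the intuitionistic predicate language with countably many individual variables, countably many predicate letters of every finite arity (including nullary letters), the constant $\bot$, the connectives $\wedge,\vee,\to$ and the quantifiers $\forall,\exists$ (no equality, constants or function symbols), with the usual Kripke semantics. In it a model over an intuitionistic Kripke frame $\langle W,R\rangle$ (a non-empty partially ordered set) has non-empty local domains $D_w$ with $D_u\subseteq D_w$ whenever $uRw$, and interprets each $n$-ary predicate letter at each world $w$ by an $n$-ary relation on $D_w$ that is preserved along $R$. A formula is true in a model if it holds at every world $w$ under every assignment that sends its free variables into $D_w$. Let $\mathbf{QSIL}_e\langle\mathbb{N},\leqslant\rangle$ be the set of formulas true in all models over the frame $\langle\mathbb{N},\leqslant\rangle$, and let $\mathbf{QSIL}(\langle\mathbb{N},\leqslant\rangle\odot\mathbb{N})$ be the set of formulas true in all models over $\langle\mathbb{N},\leqslant\rangle$ in which $D_w=\mathbb{N}$ for every world $w$. Theorem. Let $L$ be a set of formulas (in particular, any superintuitionistic predicate logic) such that $$\mathbf{QSIL}_e\langle\mathbb{N},\leqslant\rangle\subseteq L\subseteq \mathbf{QSIL}(\langle\mathbb{N},\leqslant\rangle\odot\mathbb{N}),$$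 and let $L^+$ be its positive fragment, that is, the set of those formulas in $L$ that contain no occurrence of $\bot$. Then $L^+$ is both $\Sigma^0_1$-hard and $\Pi^0_1$-hard in the language with two individual variables, a single binary predicate letter and infinitely many unary predicate letters. That is, for every set $A\subseteq\mathbb{N}$ such that $A$ or its complement is recursively enumerable, there is a computable function $f$ from $\mathbb{N}$ to the formulas of this restricted language (all of whose individual variables, free or bound, are among two fixed ones, and all of whose predicate letters are unary or equal to one fixed binary letter) such that, for every $n\in\mathbb{N}$, $n\in A$ if and only if $f(n)\in L^+$. -/

import Mathlib

universe u v

namespace IntPred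

/-- Formulas of the intuitionistic predicate language. The individual variables are indexed by `ℕ`;
`atom n i x` is the atomic formula `P(x 0, …, x (n - 1))` in which `P` is the `i`-th predicate letter
of arity `n`. -/
inductive Formula : Type
  | bot : Formula
  | atom (n i : ℕ) (x : Fin n → ℕ) : Formula
  | and (φ ψ : Formula) : Formula
  | or (φ ψ : Formula) : Formula
  | imp (φ ψ : Formula) : Formula
  | all (x : ℕ) (φ : Formula) : Formula
  | ex (x : ℕ) (φ : Formula) : Formula

namespace Formula

/-- The Gödel number of a formula. The argument tuple of an atomic formula is coded as the list of its
entries, by the standard bijection between lists of natural numbers and natural numbers. -/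
def code : Formula → ℕ
  | bot => 0
  | atom _ i x => 6 * Nat.pair i (Encodable.encode (List.ofFn x)) + 0 + 1
  | and φ ψ => 6 * Nat.pair φ.code ψ.code + 1 + 1
  | or φ ψ => 6 * Nat.pair φ.code ψ.code + 2 + 1
  | imp φ ψ => 6 * Nat.pair φ.code ψ.code + 3 + 1
  | all x φ => 6 * Nat.pair x φ.code + 4 + 1
  | ex x φ => 6 * Nat.pair x φ.code + 5 + 1

theorem unpair_fst_lt (n : ℕ) : (Nat.unpair (n / 6)).1 < n + 1 :=
  Nat.lt_succ_of_le ((Nat.unpair_left_le _).trans (Nat.div_le_self _ _))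

theorem unpair_snd_lt (n : ℕ) : (Nat.unpair (n / 6)).2 < n + 1 :=
  Nat.lt_succ_of_le ((Nat.unpair_right_le _).trans (Nat.div_le_self _ _))

/-- The atomic formula with a given list of arguments; its letter has the length of the list as arity. -/
def atomOfList (i : ℕ) (l : List ℕ) : Formula :=
  atom l.length i l.get

/-- The formula with a given Gödel number. -/
def decode : ℕ → Formula
  | 0 => bot
  | n + 1 =>
    have _h1 := unpair_fst_lt n
    have _h2 := unpair_snd_lt n
    match n % 6 with
    | 0 =>
      atomOfList (Nat.unpair (n / 6)).1 (Denumerable.ofNat (List ℕ) (Nat.unpair (n / 6)).2)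
    | 1 => and (decode (Nat.unpair (n / 6)).1) (decode (Nat.unpair (n / 6)).2)
    | 2 => or (decode (Nat.unpair (n / 6)).1) (decode (Nat.unpair (n / 6)).2)
    | 3 => imp (decode (Nat.unpair (n / 6)).1) (decode (Nat.unpair (n / 6)).2)
    | 4 => all (Nat.unpair (n / 6)).1 (decode (Nat.unpair (n / 6)).2)
    | _ => ex (Nat.unpair (n / 6)).1 (decode (Nat.unpair (n / 6)).2)
termination_by n => n

theorem atom_ofFn (i : ℕ) {n : ℕ} (x : Fin n → ℕ) :
    atomOfList i (List.ofFn x) = atom n i x := by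
  have h := List.equivSigmaTuple.right_inv (⟨n, x⟩ : Σ n, Fin n → ℕ)
  exact congrArg (fun s : Σ n, Fin n → ℕ => atom s.1 i s.2) h

theorem decode_code (φ : Formula) : decode φ.code = φ := by
  induction φ with
  | bot => rw [code, decode]
  | atom n i x =>
    rw [code, decode]
    simp only [show ∀ a, (6 * a) % 6 = 0 by omega, show ∀ a, (6 * a) / 6 = a by omega,
      Nat.unpair_pair, Denumerable.ofNat_encode]
    exact atom_ofFn i x
  | and φ ψ h1 h2 =>
    rw [code, decode]
    simp only [show ∀ a, (6 * a + 1) % 6 = 1 by omega, show ∀ a, (6 * a + 1) / 6 = a by omega,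
      Nat.unpair_pair, h1, h2]
  | or φ ψ h1 h2 =>
    rw [code, decode]
    simp only [show ∀ a, (6 * a + 2) % 6 = 2 by omega, show ∀ a, (6 * a + 2) / 6 = a by omega,
      Nat.unpair_pair, h1, h2]
  | imp φ ψ h1 h2 =>
    rw [code, decode]
    simp only [show ∀ a, (6 * a + 3) % 6 = 3 by omega, show ∀ a, (6 * a + 3) / 6 = a by omega,
      Nat.unpair_pair, h1, h2]
  | all x φ h =>
    rw [code, decode]
    simp only [show ∀ a, (6 * a + 4) % 6 = 4 by omega, show ∀ a, (6 * a + 4) / 6 = a by omega,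
      Nat.unpair_pair, h]
  | ex x φ h =>
    rw [code, decode]
    simp only [show ∀ a, (6 * a + 5) % 6 = 5 by omega, show ∀ a, (6 * a + 5) / 6 = a by omega,
      Nat.unpair_pair, h]

theorem code_decode (n : ℕ) : (decode n).code = n := by
  induction n using Nat.strong_induction_on with
  | _ n ih =>
    cases n with
    | zero => rw [decode, code]
    | succ n =>
      have h1 := ih _ (unpair_fst_lt n)
      have h2 := ih _ (unpair_snd_lt n)
      have h3 : n % 6 < 6 := Nat.mod_lt _ (by norm_num)
      have h4 := Nat.div_add_mod n 6
      rw [decode]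
      generalize hr : n % 6 = r at h3 h4
      interval_cases r
      · simp only [atomOfList, code, List.ofFn_get, Denumerable.encode_ofNat, Nat.pair_unpair]
        exact congrArg (· + 1) h4
      all_goals
        simp only [code, h1, h2, Nat.pair_unpair]
        exact congrArg (· + 1) h4

/-- The Gödel numbering is a bijection between formulas and natural numbers; through it, the notion
`Computable` of computable functions applies to formulas. -/
instance instDenumerable : Denumerable Formula :=
  Denumerable.mk' ⟨code, decode, decode_code, code_decode⟩

/-- The individual variables with a free occurrence in a formula. -/
def freeVars : Formula → Set ℕ
  | bot => ∅
  | atom _ _ x => Set.range x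
  | and φ ψ => φ.freeVars ∪ ψ.freeVars
  | or φ ψ => φ.freeVars ∪ ψ.freeVars
  | imp φ ψ => φ.freeVars ∪ ψ.freeVars
  | all x φ => φ.freeVars \ {x}
  | ex x φ => φ.freeVars \ {x}

/-- All individual variables that occur in a formula: free, bound, or next to a quantifier symbol. -/
def vars : Formula → Set ℕ
  | bot => ∅
  | atom _ _ x => Set.range x
  | and φ ψ => φ.vars ∪ ψ.vars
  | or φ ψ => φ.vars ∪ ψ.vars
  | imp φ ψ => φ.vars ∪ ψ.vars
  | all x φ => insert x φ.vars
  | ex x φ => insert x φ.vars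

/-- The predicate letters that occur in a formula, as pairs (arity, index). -/
def letters : Formula → Set (ℕ × ℕ)
  | bot => ∅
  | atom n i _ => {(n, i)}
  | and φ ψ => φ.letters ∪ ψ.letters
  | or φ ψ => φ.letters ∪ ψ.letters
  | imp φ ψ => φ.letters ∪ ψ.letters
  | all _ φ => φ.letters
  | ex _ φ => φ.letters

/-- A formula is positive if `⊥` does not occur in it. -/
def IsPositive : Formula → Prop
  | bot => False
  | atom _ _ _ => True
  | and φ ψ => φ.IsPositive ∧ ψ.IsPositive
  | or φ ψ => φ.IsPositive ∧ ψ.IsPositive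
  | imp φ ψ => φ.IsPositive ∧ ψ.IsPositive
  | all _ φ => φ.IsPositive
  | ex _ φ => φ.IsPositive

end Formula

/-- Formulas of the language with two individual variables (numbers `0` and `1`), a single binary
predicate letter (number `0` among the binary ones), and the infinitely many unary predicate letters. -/
def twoVarLang : Set Formula :=
  {φ | φ.vars ⊆ {0, 1} ∧ ∀ P ∈ φ.letters, P = (2, 0) ∨ P.1 = 1}

/-- An intuitionistic Kripke frame: a non-empty set with a partial order. -/
structure Frame : Type (u + 1) where
  World : Type u
  R : World → World → Prop
  nonempty : Nonempty World
  refl : ∀ w, R w w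
  trans : ∀ w w' w'', R w w' → R w' w'' → R w w''
  antisymm : ∀ w w', R w w' → R w' w → w = w'

/-- An intuitionistic augmented frame: an intuitionistic Kripke frame with a global domain and
non-empty local domains subject to the expanding domain condition. -/
structure AugFrame : Type (max (u + 1) (v + 1)) where
  frame : Frame.{u}
  Dom : Type v
  D : frame.World → Set Dom
  D_nonempty : ∀ w, (D w).Nonempty
  expanding : ∀ w w', frame.R w w' → D w ⊆ D w'

/-- An interpretation of the predicate letters in an augmented frame, with the heredity condition:
`rel w n i` is the relation assigned to the `i`-th `n`-ary letter at `w`, a relation on `D w`. -/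
structure Interp (F : AugFrame.{u, v}) : Type (max u v) where
  rel : F.frame.World → (n i : ℕ) → Set (Fin n → F.Dom)
  local_rel : ∀ w n i, ∀ a ∈ rel w n i, ∀ k, a k ∈ F.D w
  heredity : ∀ w w', F.frame.R w w' → ∀ n i, rel w n i ⊆ rel w' n i

/-- Truth of a formula at a world of the model `⟨F, I⟩` under an assignment `g`. -/
def Truth {F : AugFrame.{u, v}} (I : Interp F) :
    F.frame.World → (ℕ → F.Dom) → Formula → Prop
  | _, _, .bot => False
  | w, g, .atom n i x => (fun k => g (x k)) ∈ I.rel w n i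
  | w, g, .and φ ψ => Truth I w g φ ∧ Truth I w g ψ
  | w, g, .or φ ψ => Truth I w g φ ∨ Truth I w g ψ
  | w, g, .imp φ ψ => ∀ w', F.frame.R w w' → Truth I w' g φ → Truth I w' g ψ
  | w, g, .all x φ => ∀ w', F.frame.R w w' → ∀ a ∈ F.D w', Truth I w' (Function.update g x a) φ
  | w, g, .ex x φ => ∃ a ∈ F.D w, Truth I w (Function.update g x a) φ

/-- Truth of a formula in a model: at every world, under every assignment that sends the free variables
of the formula to the domain of that world. -/
def ModelTrue {F : AugFrame.{u, v}} (I : Interp F) (φ : Formula) : Prop :=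
  ∀ (w : F.frame.World) (g : ℕ → F.Dom), (∀ x ∈ φ.freeVars, g x ∈ F.D w) → Truth I w g φ

/-- Validity of a formula on an augmented frame. -/
def AugFrame.Valid (F : AugFrame.{u, v}) (φ : Formula) : Prop :=
  ∀ I : Interp F, ModelTrue I φ

/-- The superintuitionistic predicate logic of a class of augmented frames. -/
def QSIL (C : Set AugFrame.{u, v}) : Set Formula :=
  {φ | ∀ F ∈ C, F.Valid φ}

/-- The class of the augmented frames (with expanding domains) based on frames of a given class. -/
def augE (C : Set Frame.{u}) : Set AugFrame.{u, v} :=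
  {F | F.frame ∈ C}

/-- The logic of the augmented frames (with expanding domains) based on frames of a given class. -/
def QSILe (C : Set Frame.{u}) : Set Formula :=
  QSIL (augE.{u, v} C)

/-- The augmented frame `F ⊙ A`, with the constant domain `A`. -/
def Frame.odot (F : Frame.{u}) (A : Type v) [Nonempty A] : AugFrame.{u, v} where
  frame := F
  Dom := A
  D := fun _ => Set.univ
  D_nonempty := fun _ => Set.univ_nonempty
  expanding := fun _ _ _ => subset_rfl

/-- The Kripke frame `⟨ℕ, ≤⟩`. -/
def natFrame : Frame.{0} where
  World := ℕ
  R := fun m n => m ≤ n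
  nonempty := ⟨0⟩
  refl := fun n => le_refl n
  trans := fun _ _ _ h h' => le_trans h h'
  antisymm := fun _ _ h h' => le_antisymm h h'

/-- The positive fragment of a set of formulas. -/
def positiveFragment (L : Set Formula) : Set Formula :=
  {φ ∈ L | φ.IsPositive}

/-- The set `A` of natural numbers is many-one reducible to the problem of deciding, for formulas of
the language `K`, membership in `S`. -/
def ReducesIn (A : ℕ → Prop) (S K : Set Formula) : Prop :=
  ∃ f : ℕ → Formula, Computable f ∧ (∀ n, f n ∈ K) ∧ ∀ n, A n ↔ f n ∈ S

/-- `S` is `Σ⁰₁`-hard in the language `K`. -/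
def SigmaOneHardIn (S K : Set Formula) : Prop :=
  ∀ A : ℕ → Prop, REPred A → ReducesIn A S K

/-- `S` is `Π⁰₁`-hard in the language `K`. -/
def PiOneHardIn (S K : Set Formula) : Prop :=
  ∀ A : ℕ → Prop, REPred (fun n => ¬ A n) → ReducesIn A S K

end IntPred

/-!
In a model over `⟨ℕ, ≤⟩`, let the value of a unary letter at an element be the first world at which
the letter holds of the element, or `⊤`. The implication `Q(y) → P(x)` then says that the value of
`P` at `x` is at most the value of `Q` at `y`, and `(P(x) → Q(y)) → Q(y)` says that `P` at `x` is
strictly below `Q` at `y`, up to the degenerate case that `Q(y)` holds already. So strict inequality,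
hence negation, has a positive expression, and every positive combination of comparisons between
`ℕ∞`-valued unary functions, with quantifiers over two variables, is the meaning of a positive
formula in unary letters (`Con.toFormula`). Over expanding domains, truth of the formula at a world
yields satisfaction of the constraint by the local domain (`Con.sat_of_truth`); in the standard
model with constant domain `ℕ`, satisfaction yields truth at the world `0`
(`Con.truth_stdInterp`). The role of `⊥` is played by `∃x Z(x)`, where `Z` has the least value.

Such constraints describe the natural numbers categorically. If `T(x) < S(x)` for all `x`, no value
of `T` lies strictly between `T(x)` and `S(x)`, and `S(x)` is always a value of `T`, then the values
of `T` are finite, hence form a sequence of type `ω`, because only finitely many worlds precede a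
given one (`Con.exists_numbering`). Over such a numbering, two variables suffice to define every
primitive recursive function, in the form of one letter per unary function: a composition
`F(G(x))` is looked up at an element `y` with `T(y) = G(x)`, and pairs are obtained by defining
the two components of `k + 1` from those of `k` (`definable_of_primrec`).

If a set is recursively enumerable, it is the set of all `n` such that some `m` with left component
`n` is a zero of a certain primitive recursive `g`. That there is such an `m`, and that there is none,
are both expressible. Consequently there are formulas `c → ∃x Z(x)`, computable from `n`, that are
refuted in the standard model if `n` belongs to the set, and valid over all expanding domains
otherwise; and others with the two cases exchanged. The binary letter is not needed.
-/

namespace IntPred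

/-! ### Comparison constraints -/

/-- A positive two-variable first-order language that compares values of unary letters. A term is a
pair `(i, x)`, to be read as the value of the unary letter `i` at the variable `x`; the two
variables are `false` and `true`. There is no negation: `lt` serves as the negation of `le`. -/
inductive Con : Type
  | le (s t : ℕ × Bool) : Con
  | lt (s t : ℕ × Bool) : Con
  | and (c d : Con) : Con
  | or (c d : Con) : Con
  | all (x : Bool) (c : Con) : Con
  | ex (x : Bool) (c : Con) : Con

namespace Con

/-- Classical satisfaction of a constraint in a structure where each letter is a function to `ℕ∞`. -/
def Sat {D : Type v} (V : ℕ → D → ℕ∞) : (Bool → D) → Con → Prop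
  | e, .le s t => V s.1 (e s.2) ≤ V t.1 (e t.2)
  | e, .lt s t => V s.1 (e s.2) < V t.1 (e t.2)
  | e, .and c d => Sat V e c ∧ Sat V e d
  | e, .or c d => Sat V e c ∨ Sat V e d
  | e, .all x c => ∀ a, Sat V (Function.update e x a) c
  | e, .ex x c => ∃ a, Sat V (Function.update e x a) c

def eq (s t : ℕ × Bool) : Con := and (le s t) (le t s)

def ne (s t : ℕ × Bool) : Con := or (lt s t) (lt t s)

/-- Universal closure. -/
def all₂ (c : Con) : Con := all false (all true c)

section
variable {D : Type v} {V : ℕ → D → ℕ∞} {e : Bool → D}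

@[simp] theorem sat_le {s t} : Sat V e (le s t) ↔ V s.1 (e s.2) ≤ V t.1 (e t.2) := Iff.rfl

@[simp] theorem sat_lt {s t} : Sat V e (lt s t) ↔ V s.1 (e s.2) < V t.1 (e t.2) := Iff.rfl

@[simp] theorem sat_and {c d} : Sat V e (and c d) ↔ Sat V e c ∧ Sat V e d := Iff.rfl

@[simp] theorem sat_or {c d} : Sat V e (or c d) ↔ Sat V e c ∨ Sat V e d := Iff.rfl

@[simp] theorem sat_all {x c} : Sat V e (all x c) ↔ ∀ a, Sat V (Function.update e x a) c := Iff.rfl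

@[simp] theorem sat_ex {x c} : Sat V e (ex x c) ↔ ∃ a, Sat V (Function.update e x a) c := Iff.rfl

@[simp] theorem sat_eq {s t} : Sat V e (eq s t) ↔ V s.1 (e s.2) = V t.1 (e t.2) :=
  le_antisymm_iff.symm

@[simp] theorem sat_ne {s t} : Sat V e (ne s t) ↔ V s.1 (e s.2) ≠ V t.1 (e t.2) :=
  lt_or_lt_iff_ne

@[simp] theorem sat_all₂ {c} : Sat V e (all₂ c) ↔ ∀ a b, Sat V (fun x => cond x b a) c := by
  have h : ∀ a b, Function.update (Function.update e false a) true b = fun x => cond x b a := by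
    intro a b
    funext x
    cases x <;> simp
  simp [all₂, h]

end

end Con

/-! ### The standard letters -/

open Classical in
/-- An enumeration of functions in which every primitive recursive function occurs: the `j`-th one
is computed by the `j`-th code, with value `0` where that code diverges. It is the intended meaning
of the unary letters. -/
noncomputable def stdFun (j k : ℕ) : ℕ :=
  ((Denumerable.ofNat Nat.Partrec.Code j).eval k).getOrElse 0

/-- A letter whose intended meaning is `f`; junk unless `f` occurs in the enumeration `stdFun`. -/
noncomputable def letter (f : ℕ → ℕ) : ℕ := Function.invFun stdFun f

theorem stdFun_letter {f : ℕ → ℕ} (hf : Nat.Primrec f) : stdFun (letter f) = f := by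
  apply Function.invFun_eq
  obtain ⟨c, hc⟩ := Nat.Partrec.Code.exists_code.1 (Nat.Partrec.of_primrec hf)
  refine ⟨Encodable.encode c, ?_⟩
  funext k
  simp [stdFun, hc]

/-- The letter of `f` at a variable. -/
noncomputable def tm (f : ℕ → ℕ) (x : Bool) : ℕ × Bool := (letter f, x)

/-- The letter of the zero function. -/
noncomputable def zeroLetter : ℕ := letter fun _ => 0

/-- The values of the letters in the standard structure. -/
noncomputable def stdVal (j k : ℕ) : ℕ∞ := (stdFun j k : ℕ∞)

theorem stdVal_letter {f : ℕ → ℕ} (hf : Nat.Primrec f) (k : ℕ) : stdVal (letter f) k = f k := by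
  rw [stdVal, stdFun_letter hf]

/-! ### Constraints as formulas -/

namespace Con

/-- The atomic formula of a term. -/
def atomOf (s : ℕ × Bool) : Formula := .atom 1 s.1 fun _ => s.2.toNat

/-- The formula of a constraint. Evaluated at a world `w` of `⟨ℕ, ≤⟩`, the formula for `lt` without
its second conjunct would express `s < t ∨ t ≤ w`; the second conjunct makes the value of `t` at
least that of the zero letter, which is larger than `w` wherever `goal` is refuted. -/
noncomputable def toFormula : Con → Formula
  | le s t => .imp (atomOf t) (atomOf s)
  | lt s t => .and (.imp (.imp (atomOf s) (atomOf t)) (atomOf t))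
      (.imp (atomOf t) (atomOf (zeroLetter, t.2)))
  | and c d => .and c.toFormula d.toFormula
  | or c d => .or c.toFormula d.toFormula
  | all x c => .all x.toNat c.toFormula
  | ex x c => .ex x.toNat c.toFormula

/-- A positive substitute for `⊥`: where it fails, the zero letter fails at all elements of the local
domain. -/
noncomputable def goal : Formula := .ex 0 (.atom 1 zeroLetter fun _ => 0)

theorem isPositive (c : Con) : c.toFormula.IsPositive := by
  induction c <;> simp_all [toFormula, atomOf, Formula.IsPositive]

theorem toNat_mem (x : Bool) : x.toNat ∈ ({0, 1} : Set ℕ) := by cases x <;> simp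

theorem toNat_ne {x y : Bool} (h : y ≠ x) : y.toNat ≠ x.toNat := by
  cases x <;> cases y <;> simp_all

theorem update_toNat {A : Type*} {g : ℕ → A} {e : Bool → A} (he : ∀ x, g (Bool.toNat x) = e x)
    (x : Bool) (a : A) (y : Bool) :
    Function.update g x.toNat a y.toNat = Function.update e x a y := by
  by_cases hy : y = x
  · simp [hy]
  · simp [hy, toNat_ne hy, he]

theorem vars_toFormula (c : Con) : c.toFormula.vars ⊆ {0, 1} := by
  induction c with
  | le s t => simp only [toFormula, atomOf, Formula.vars, Set.range_const, Set.union_subset_iff,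
      Set.singleton_subset_iff, toNat_mem, and_self]
  | lt s t => simp only [toFormula, atomOf, Formula.vars, Set.range_const, Set.union_subset_iff,
      Set.singleton_subset_iff, toNat_mem, and_self]
  | and c d hc hd => exact Set.union_subset hc hd
  | or c d hc hd => exact Set.union_subset hc hd
  | all x c hc => exact Set.insert_subset (toNat_mem x) hc
  | ex x c hc => exact Set.insert_subset (toNat_mem x) hc

theorem letters_toFormula (c : Con) : ∀ P ∈ c.toFormula.letters, P.1 = 1 := by
  induction c with
  | le s t => simp [toFormula, atomOf, Formula.letters]
  | lt s t => simp [toFormula, atomOf, Formula.letters]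
  | and c d hc hd => exact fun P hP => hP.elim (hc P) (hd P)
  | or c d hc hd => exact fun P hP => hP.elim (hc P) (hd P)
  | all x c hc => exact hc
  | ex x c hc => exact hc

theorem imp_goal_mem_twoVarLang (c : Con) : Formula.imp c.toFormula goal ∈ twoVarLang := by
  refine ⟨Set.union_subset c.vars_toFormula ?_, fun P hP => Or.inr ?_⟩
  · simp [goal, Formula.vars]
  · rcases hP with hP | hP
    · exact c.letters_toFormula P hP
    · simp only [goal, Formula.letters, Set.mem_singleton_iff] at hP
      simp [hP]

end Con

/-! ### Models over the frame of natural numbers -/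

/-- Truth is preserved along the accessibility relation. -/
theorem Truth.mono {F : AugFrame.{u, v}} {I : Interp F} {φ : Formula} :
    ∀ {w w' : F.frame.World} {g : ℕ → F.Dom}, F.frame.R w w' → Truth I w g φ → Truth I w' g φ := by
  induction φ with
  | bot => exact fun _ h => h
  | atom n i x => exact fun hR h => I.heredity _ _ hR n i h
  | and φ ψ h1 h2 => exact fun hR h => ⟨h1 hR h.1, h2 hR h.2⟩
  | or φ ψ h1 h2 => exact fun hR h => h.imp (h1 hR) (h2 hR)
  | imp φ ψ _ _ => exact fun hR h u hu => h u (F.frame.trans _ _ _ hR hu)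
  | all x φ _ => exact fun hR h u hu => h u (F.frame.trans _ _ _ hR hu)
  | ex x φ h1 => exact fun hR ⟨a, ha, h⟩ => ⟨a, F.expanding _ _ hR ha, h1 hR h⟩

section Values

/-- The augmented frame over `⟨ℕ, ≤⟩` with given local domains. -/
abbrev natAug (A : Type v) (D : ℕ → Set A) (hne : ∀ w, (D w).Nonempty)
    (hexp : ∀ w w' : ℕ, w ≤ w' → D w ⊆ D w') : AugFrame.{0, v} :=
  ⟨natFrame, A, D, hne, hexp⟩

variable {A : Type v} {D : ℕ → Set A} {hne : ∀ w, (D w).Nonempty}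
  {hexp : ∀ w w' : ℕ, w ≤ w' → D w ⊆ D w'} (I : Interp (natAug A D hne hexp))

/-- The value of a unary letter at an element of `D w`: the first world from `w` on at which the
letter holds of the element, and `⊤` if there is none. -/
noncomputable def val (w i : ℕ) (a : D w) : ℕ∞ :=
  sInf ((fun u : ℕ => (u : ℕ∞)) '' {u : ℕ | w ≤ u ∧ (fun _ => a.1) ∈ I.rel u 1 i})

theorem val_le_coe {w i u : ℕ} {a : D w} (hu : w ≤ u) :
    val I w i a ≤ u ↔ (fun _ => a.1) ∈ I.rel u 1 i := by
  constructor
  · intro h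
    rcases Set.eq_empty_or_nonempty {u : ℕ | w ≤ u ∧ (fun _ => a.1) ∈ I.rel u 1 i} with h0 | h0
    · rw [val, h0] at h
      simp at h
    · obtain ⟨u', ⟨-, h1⟩, h2⟩ := csInf_mem (h0.image fun u : ℕ => (u : ℕ∞))
      rw [val, ← h2] at h
      exact I.heredity u' u (Nat.cast_le.1 h) 1 i h1
  · exact fun h => sInf_le ⟨u, ⟨hu, h⟩, rfl⟩

theorem val_le_val {w i j : ℕ} {a b : D w}
    (h : ∀ u, w ≤ u → (fun _ => a.1) ∈ I.rel u 1 i → (fun _ => b.1) ∈ I.rel u 1 j) :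
    val I w j b ≤ val I w i a :=
  sInf_le_sInf (Set.image_mono fun u hu => ⟨hu.1, h u hu.1 hu.2⟩)

/-- A constraint whose formula is true at a world where `goal` fails is satisfied by the values
of the letters over the domain of that world. -/
theorem Con.sat_of_truth {w : ℕ} (hZ : ∀ a ∈ D w, (fun _ => a) ∉ I.rel w 1 zeroLetter) {c : Con} :
    ∀ {g : ℕ → A} {e : Bool → D w}, (∀ x, g (Bool.toNat x) = e x) →
      Truth I w g c.toFormula → c.Sat (val I w) e := by
  induction c with
  | le s t =>
    intro g e he h
    refine val_le_val I fun u hu ht => ?_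
    have h' := h u hu
    simp only [Con.atomOf, Truth, he] at h'
    exact h' ht
  | lt s t =>
    intro g e he h
    by_contra hst
    obtain ⟨h1, h2⟩ := h
    have ht : (fun _ => (e t.2).1) ∈ I.rel w 1 t.1 := by
      have h1' := h1 w le_rfl
      simp only [Con.atomOf, Truth, he] at h1'
      refine h1' fun u hu hs => ?_
      rw [Con.sat_lt, not_lt] at hst
      exact (val_le_coe I hu).1 (hst.trans ((val_le_coe I hu).2 hs))
    have h2' := h2 w le_rfl
    simp only [Con.atomOf, Truth, he] at h2'
    exact hZ _ (e t.2).2 (h2' ht)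
  | and c d hc hd => exact fun he h => ⟨hc he h.1, hd he h.2⟩
  | or c d hc hd => exact fun he h => h.imp (hc he) (hd he)
  | all x c hc =>
    intro g e he h a
    refine hc (fun y => ?_) (h w le_rfl a a.2)
    by_cases hy : y = x
    · simp [hy]
    · simp [hy, Con.toNat_ne hy, he]
  | ex x c hc =>
    rintro g e he ⟨a, ha, h⟩
    refine ⟨⟨a, ha⟩, hc (fun y => ?_) h⟩
    by_cases hy : y = x
    · simp [hy]
    · simp [hy, Con.toNat_ne hy, he]

end Values

/-- If no structure satisfies a constraint, then the implication from its universal closure to `goal`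
is valid on all augmented frames over `⟨ℕ, ≤⟩`. -/
theorem Con.mem_QSILe {c : Con}
    (h : ∀ (D : Type v) (V : ℕ → D → ℕ∞) (e : Bool → D), ¬ c.Sat V e) :
    Formula.imp (all₂ c).toFormula goal ∈ QSILe.{0, v} {natFrame} := by
  rintro ⟨fr, A, D, hne, hexp⟩ hF
  obtain rfl : fr = natFrame := hF
  intro I w g _ w' _ hc
  by_contra hgoal
  have hZ : ∀ a ∈ D w', (fun _ => a) ∉ I.rel w' 1 zeroLetter := by
    intro a ha hmem
    refine hgoal ⟨a, ha, ?_⟩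
    simpa only [Truth, Function.update_self] using hmem
  obtain ⟨a, ha⟩ := hne w'
  have hc' := hc w' le_rfl a ha w' le_rfl a ha
  refine h _ _ _ (Con.sat_of_truth (hne := hne) (hexp := hexp) I hZ
    (e := fun _ => ⟨a, ha⟩) (fun x => ?_) hc')
  cases x <;> simp

/-- The standard model, in which the `i`-th unary letter holds of `k` at the worlds larger than
`stdFun i k`. The shift by one makes every letter false at the world `0`. -/
noncomputable def stdInterp : Interp (natFrame.odot ℕ) where
  rel w n i := {a | n = 1 ∧ ∀ k, stdFun i (a k) < w}
  local_rel _ _ _ _ _ _ := Set.mem_univ _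
  heredity _ _ h _ _ _ ha := ⟨ha.1, fun k => (ha.2 k).trans_le h⟩

theorem mem_stdInterp {w i a : ℕ} : (fun _ => a) ∈ stdInterp.rel w 1 i ↔ stdFun i a < w :=
  ⟨fun h => h.2 0, fun h => ⟨rfl, fun _ => h⟩⟩

theorem stdFun_zeroLetter (k : ℕ) : stdFun zeroLetter k = 0 :=
  congrFun (stdFun_letter Nat.Primrec.zero) k

/-- Every constraint that the standard structure satisfies has a formula true at the world `0` of the
standard model. Heredity and the constant domain reduce the universal quantifier to that world. -/
theorem Con.truth_stdInterp {c : Con} :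
    ∀ {g : ℕ → ℕ} {e : Bool → ℕ}, (∀ x, g (Bool.toNat x) = e x) →
      c.Sat stdVal e → Truth stdInterp (0 : ℕ) g c.toFormula := by
  induction c with
  | le s t =>
    intro g e he h u _ ht
    simp only [Con.atomOf, Truth, he] at ht ⊢
    exact mem_stdInterp.2 ((Nat.cast_le.1 h).trans_lt (mem_stdInterp.1 ht))
  | lt s t =>
    intro g e he h
    have h : stdFun s.1 (e s.2) < stdFun t.1 (e t.2) := Nat.cast_lt.1 h
    refine ⟨fun u _ hu => ?_, fun u _ hu => ?_⟩
    · simp only [Con.atomOf, Truth, he] at hu ⊢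
      by_contra hlt
      -- Otherwise the last world at which `t` fails is a world at which `s` holds.
      have hle := not_lt.1 fun h' => hlt (mem_stdInterp.2 h')
      exact lt_irrefl _ (mem_stdInterp.1 (hu (stdFun t.1 (e t.2)) hle (mem_stdInterp.2 h)))
    · simp only [Con.atomOf, Truth, he] at hu ⊢
      refine mem_stdInterp.2 ?_
      rw [stdFun_zeroLetter]
      exact (Nat.zero_le _).trans_lt (mem_stdInterp.1 hu)
  | and c d hc hd => exact fun he h => ⟨hc he h.1, hd he h.2⟩
  | or c d hc hd => exact fun he h => h.imp (hc he) (hd he)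
  | all x c hc =>
    intro g e he h u hu a _
    refine Truth.mono (w := (0 : ℕ)) hu (hc (Con.update_toNat he x a) (h a))
  | ex x c hc =>
    rintro g e he ⟨a, h⟩
    exact ⟨a, Set.mem_univ _, hc (Con.update_toNat he x a) h⟩

/-- If the standard structure satisfies a constraint under all assignments, then the implication
from its universal closure to `goal` is refuted in the standard model. -/
theorem Con.notMem_QSIL {c : Con} (h : ∀ e, c.Sat stdVal e) :
    Formula.imp (all₂ c).toFormula goal ∉ QSIL {natFrame.odot ℕ} := by
  intro hmem
  have h1 := hmem _ rfl stdInterp (0 : ℕ) (fun _ => (0 : ℕ)) (fun _ _ => Set.mem_univ _) (0 : ℕ)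
    le_rfl
    (Con.truth_stdInterp (e := fun _ => 0) (fun _ => rfl) (sat_all₂.2 fun _ _ => h _))
  obtain ⟨a, -, ha⟩ := h1
  exact absurd (mem_stdInterp.1 ha) (Nat.not_lt_zero _)

/-! ### Numberings -/

/-- The values of the letter of the identity are enumerated, in increasing order, by `num`, and the
letters of zero and successor act on them accordingly. An element `x` then stands for the number `k`
with `V (letter id) x = num k`. -/
structure Numbering {D : Type v} (V : ℕ → D → ℕ∞) (num : ℕ → ℕ∞) : Prop where
  strictMono : StrictMono num
  zero : ∀ x, V zeroLetter x = num 0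
  succ : ∀ x k, V (letter id) x = num k → V (letter Nat.succ) x = num (k + 1)
  exists_num : ∀ x, ∃ k, V (letter id) x = num k
  exists_elem : ∀ k, ∃ x, V (letter id) x = num k

namespace Con

/-- The constraint that forces a numbering. -/
noncomputable def base : Con :=
  (all₂ (eq (tm (fun _ => 0) false) (tm (fun _ => 0) true))).and <|
  (ex false (eq (tm id false) (tm (fun _ => 0) false))).and <|
  (all₂ (le (tm (fun _ => 0) false) (tm id false))).and <|
  (all₂ (lt (tm id false) (tm Nat.succ false))).and <|
  (all₂ (or (le (tm id true) (tm id false)) (le (tm Nat.succ false) (tm id true)))).and <|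
  all false (ex true (eq (tm id true) (tm Nat.succ false)))

theorem sat_base_std (e : Bool → ℕ) : base.Sat stdVal e := by
  simp only [base, tm, sat_and, sat_all₂, sat_eq, sat_ex, sat_le, sat_lt, sat_or, sat_all, cond_true,
    cond_false, Function.update_self, stdVal_letter Nat.Primrec.zero, stdVal_letter Nat.Primrec.id,
    stdVal_letter Nat.Primrec.succ, Nat.cast_le, Nat.cast_lt, Nat.cast_inj]
  simp
  intros; omega

/-- The constraint `base` forces a numbering: the values of the letter of the identity are closed under
successor, without gaps, and finite. -/
theorem exists_numbering {D : Type v} {V : ℕ → D → ℕ∞} {e : Bool → D} (h : base.Sat V e) :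
    ∃ num, Numbering V num := by
  simp only [base, tm, sat_and, sat_all₂, sat_eq, sat_ex, sat_le, sat_lt, sat_or, sat_all, cond_true,
    cond_false, Function.update_self] at h
  obtain ⟨hz, ⟨x₀, hx₀⟩, hle, hlt, hgap, hsucc⟩ := h
  simp at hle hlt hsucc
  choose next hnext using hsucc
  set T := V (letter id) with hT
  set S := V (letter Nat.succ) with hS
  have hlt : ∀ x, T x < S x := fun x => hlt x x
  have hT_next : ∀ x, T x < T (next x) := fun x => (hnext x).symm ▸ hlt x
  -- `S` is a function of `T`, because no value of `T` lies strictly between `T x` and `S x`.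
  have hS_le : ∀ x y, T x ≤ T y → S x ≤ S y := by
    intro x y hxy
    rcases hgap x (next y) with h | h
    · exact absurd (hxy.trans_lt (hT_next y)) (not_lt.2 h)
    · rwa [hnext] at h
  let it : ℕ → D := fun k => next^[k] x₀
  have hit : ∀ k, it (k + 1) = next (it k) := fun k => Function.iterate_succ_apply' _ _ _
  have hmono : StrictMono fun k => T (it k) := strictMono_nat_of_lt_succ fun k => by
    simpa only [hit] using hT_next (it k)
  refine ⟨fun k => T (it k), hmono, fun x => ?_, fun x k hk => ?_, fun x => ?_, fun k => ⟨_, rfl⟩⟩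
  · exact (hz x x₀).trans hx₀.symm
  · change S x = T (it (k + 1))
    rw [hit, hnext]
    exact le_antisymm (hS_le _ _ hk.le) (hS_le _ _ hk.ge)
  · -- `T x` is finite, so the strictly increasing values `T (it k)` pass it.
    have hk : ∀ k : ℕ, (k : ℕ∞) ≤ T (it k) := by
      intro k
      induction k with
      | zero => simp
      | succ k ih =>
        rw [Nat.cast_succ]
        exact Order.add_one_le_of_lt (ih.trans_lt (hmono (Nat.lt_succ_self k)))
    obtain ⟨m, hm⟩ := ENat.ne_top_iff_exists.1 (hlt x).ne_top
    have hex : ∃ k, T x < T (it k) :=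
      ⟨m + 1, hm ▸ (Nat.cast_lt.2 (Nat.lt_succ_self m)).trans_le (hk (m + 1))⟩
    classical
    obtain ⟨k, hk1, hk2⟩ : ∃ k, T x < T (it (k + 1)) ∧ T (it k) ≤ T x := by
      have h1 := Nat.find_spec hex
      have h2 := fun k => Nat.find_min hex (m := k)
      generalize Nat.find hex = j at h1 h2
      cases j with
      | zero =>
        refine absurd h1 (not_lt.2 ?_)
        rw [show T (it 0) = _ from hx₀, hz x₀ x]
        exact hle x x
      | succ k => exact ⟨k, h1, not_lt.1 (h2 k (Nat.lt_succ_self k))⟩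
    refine ⟨k, le_antisymm ?_ hk2⟩
    rcases hgap (it k) x with h | h
    · exact h
    · rw [← hnext, ← hit] at h
      exact absurd hk1 (not_lt.2 h)

end Con

/-! ### Defining primitive recursive functions -/

/-- The letter `j` acts on the numbers of a numbering as the function `f`. -/
def Represents {D : Type v} (V : ℕ → D → ℕ∞) (num : ℕ → ℕ∞) (j : ℕ) (f : ℕ → ℕ) : Prop :=
  ∀ x k, V (letter id) x = num k → V j x = num (f k)

/-- Some constraint, satisfied in the standard structure, forces the letter of `f` to represent `f`
in every numbered structure. -/
def Definable (f : ℕ → ℕ) : Prop :=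
  ∃ c : Con, (∀ e, c.Sat stdVal e) ∧ ∀ (D : Type v) (V : ℕ → D → ℕ∞) (num : ℕ → ℕ∞) (e : Bool → D),
    Numbering V num → c.Sat V e → Represents V num (letter f) f

namespace Con

/-- The constraint `H(x) = F(G(x))`. -/
noncomputable def comp (F G H : ℕ → ℕ) : Con :=
  all₂ (or (ne (tm id true) (tm G false)) (eq (tm H false) (tm F true)))

/-- The constraint `P(x) = ⟨G(x), H(x)⟩`. -/
noncomputable def pair (G H P : ℕ → ℕ) : Con :=
  all₂ (or (ne (tm (fun k => k.unpair.1) true) (tm G false))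
    (or (ne (tm (fun k => k.unpair.2) true) (tm H false)) (eq (tm P false) (tm id true))))

theorem sat_comp_std {F G H : ℕ → ℕ} (hF : Nat.Primrec F) (hG : Nat.Primrec G)
    (hH : ∀ k, H k = F (G k)) (e : Bool → ℕ) : (comp F G H).Sat stdVal e := by
  have hH' : Nat.Primrec H := (funext hH : H = fun k => F (G k)) ▸ hF.comp hG
  simp only [comp, tm, sat_all₂, sat_or, sat_ne, sat_eq, cond_true, cond_false,
    stdVal_letter Nat.Primrec.id, stdVal_letter hF, stdVal_letter hG, stdVal_letter hH', id, ne_eq,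
    Nat.cast_inj, hH]
  intro a b
  by_cases h : b = G a
  · exact Or.inr (h ▸ rfl)
  · exact Or.inl h

theorem sat_pair_std {G H P : ℕ → ℕ} (hG : Nat.Primrec G) (hH : Nat.Primrec H)
    (hP : ∀ k, P k = Nat.pair (G k) (H k)) (e : Bool → ℕ) : (pair G H P).Sat stdVal e := by
  have hP' : Nat.Primrec P := (funext hP : P = fun k => Nat.pair (G k) (H k)) ▸ hG.pair hH
  simp only [pair, tm, sat_all₂, sat_or, sat_ne, sat_eq, cond_true, cond_false,
    stdVal_letter Nat.Primrec.id, stdVal_letter Nat.Primrec.left, stdVal_letter Nat.Primrec.right,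
    stdVal_letter hG, stdVal_letter hH, stdVal_letter hP', id, ne_eq, Nat.cast_inj, hP]
  intro a b
  by_cases h : b.unpair.1 = G a
  · by_cases h' : b.unpair.2 = H a
    · exact Or.inr (Or.inr (by rw [← h, ← h', Nat.pair_unpair]))
    · exact Or.inr (Or.inl h')
  · exact Or.inl h

section
variable {D : Type v} {V : ℕ → D → ℕ∞} {num : ℕ → ℕ∞} {e : Bool → D}

theorem comp_apply {F G H : ℕ → ℕ} (hN : Numbering V num) (h : (comp F G H).Sat V e)
    (hF : Represents V num (letter F) F) {x k} (hG : V (letter G) x = num k) :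
    V (letter H) x = num (F k) := by
  simp only [comp, tm, sat_all₂, sat_or, sat_ne, sat_eq, cond_true, cond_false] at h
  obtain ⟨y, hy⟩ := hN.exists_elem k
  rcases h x y with h | h
  · exact absurd (hy.trans hG.symm) h
  · rw [h, hF y k hy]

theorem pair_apply {G H P : ℕ → ℕ} (hN : Numbering V num) (h : (pair G H P).Sat V e)
    (hl : Represents V num (letter fun k => k.unpair.1) fun k => k.unpair.1)
    (hr : Represents V num (letter fun k => k.unpair.2) fun k => k.unpair.2)
    {x a b} (hG : V (letter G) x = num a) (hH : V (letter H) x = num b) :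
    V (letter P) x = num (Nat.pair a b) := by
  simp only [pair, tm, sat_all₂, sat_or, sat_ne, sat_eq, cond_true, cond_false] at h
  obtain ⟨y, hy⟩ := hN.exists_elem (Nat.pair a b)
  have h1 := hl y _ hy
  have h2 := hr y _ hy
  simp only [Nat.unpair_pair] at h1 h2
  rcases h x y with h | h | h
  · exact absurd (h1.trans hG.symm) h
  · exact absurd (h2.trans hH.symm) h
  · rw [h, hy]

end

end Con

open IntPred.Con

theorem definable_zero : Definable.{v} fun _ => 0 := by
  refine ⟨base, sat_base_std, fun D V num e hN _ x k _ => hN.zero x⟩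

theorem definable_succ : Definable.{v} Nat.succ := by
  refine ⟨base, sat_base_std, fun D V num e hN _ x k hk => hN.succ x k hk⟩

theorem Definable.comp {f g : ℕ → ℕ} (hf : Nat.Primrec f) (hg : Nat.Primrec g)
    (df : Definable.{v} f) (dg : Definable.{v} g) : Definable.{v} fun k => f (g k) := by
  obtain ⟨c, hc, hc'⟩ := df
  obtain ⟨d, hd, hd'⟩ := dg
  refine ⟨(c.and d).and (Con.comp f g _),
    fun e => ⟨⟨hc e, hd e⟩, sat_comp_std hf hg (fun _ => rfl) e⟩, ?_⟩
  rintro D V num e hN ⟨⟨h1, h2⟩, h3⟩ x k hk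
  exact comp_apply hN h3 (hc' D V num e hN h1) (hd' D V num e hN h2 x k hk)

/-- The inverse of the pairing function computed by recursion: how `Nat.unpair` passes from a
number to the next one. -/
theorem unpair_succ (k : ℕ) :
    (k.unpair.1 + 1 < k.unpair.2 ∧ (k + 1).unpair.1 = k.unpair.1 + 1 ∧
      (k + 1).unpair.2 = k.unpair.2) ∨
    (k.unpair.1 + 1 = k.unpair.2 ∧ (k + 1).unpair.1 = k.unpair.2 ∧ (k + 1).unpair.2 = 0) ∨
    (k.unpair.2 < k.unpair.1 ∧ (k + 1).unpair.1 = k.unpair.1 ∧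
      (k + 1).unpair.2 = k.unpair.2 + 1) ∨
    (k.unpair.1 = k.unpair.2 ∧ (k + 1).unpair.1 = 0 ∧ (k + 1).unpair.2 = k.unpair.1 + 1) := by
  have hk := Nat.pair_unpair k
  generalize k.unpair.1 = a at hk ⊢
  generalize k.unpair.2 = b at hk ⊢
  subst hk
  have key : ∀ c d, Nat.pair c d = Nat.pair a b + 1 →
      (Nat.pair a b + 1).unpair.1 = c ∧ (Nat.pair a b + 1).unpair.2 = d := by
    intro c d h
    simp [← h]
  rcases lt_trichotomy (a + 1) b with h | h | h
  · refine Or.inl ⟨h, key _ _ ?_⟩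
    simp only [Nat.pair, h, (Nat.lt_succ_self a).trans h, if_true]
    omega
  · refine Or.inr (Or.inl ⟨h, key _ _ ?_⟩)
    subst h
    simp only [Nat.pair, Nat.lt_succ_self, if_true, Nat.not_lt_zero, if_false]
    ring
  · rcases Nat.lt_or_ge b a with h' | h'
    · refine Or.inr (Or.inr (Or.inl ⟨h', key _ _ ?_⟩))
      simp only [Nat.pair, show ¬ a < b + 1 by omega, show ¬ a < b by omega, if_false]
      omega
    · obtain rfl : a = b := by omega
      refine Or.inr (Or.inr (Or.inr ⟨rfl, key _ _ ?_⟩))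
      simp only [Nat.pair, Nat.succ_pos, lt_irrefl, if_true, if_false]
      ring

/-- The recursion of `unpair_succ` as a constraint. -/
noncomputable def unpairCon : Con :=
  let L := tm fun k => k.unpair.1
  let R := tm fun k => k.unpair.2
  let SL := tm fun k => k.unpair.1.succ
  let SR := tm fun k => k.unpair.2.succ
  let Z := tm fun _ => 0
  ((Con.comp Nat.succ (fun k => k.unpair.1) fun k => k.unpair.1.succ).and
    (Con.comp Nat.succ (fun k => k.unpair.2) fun k => k.unpair.2.succ)).and <|
  (all₂ (or (ne (tm id false) (Z false))
    (and (eq (L false) (Z false)) (eq (R false) (Z false))))).and <|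
  all₂ (or (ne (tm id true) (tm Nat.succ false)) <|
    or (and (lt (SL false) (R false)) (and (eq (L true) (SL false)) (eq (R true) (R false)))) <|
    or (and (eq (SL false) (R false)) (and (eq (L true) (R false)) (eq (R true) (Z false)))) <|
    or (and (lt (R false) (L false)) (and (eq (L true) (L false)) (eq (R true) (SR false)))) <|
    and (eq (L false) (R false)) (and (eq (L true) (Z false)) (eq (R true) (SL false))))

theorem sat_unpairCon_std (e : Bool → ℕ) : unpairCon.Sat stdVal e := by
  refine ⟨⟨sat_comp_std Nat.Primrec.succ Nat.Primrec.left (fun _ => rfl) e,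
    sat_comp_std Nat.Primrec.succ Nat.Primrec.right (fun _ => rfl) e⟩, ?_, ?_⟩
  · simp only [tm, sat_all₂, sat_or, sat_and, sat_ne, sat_eq, cond_false,
      stdVal_letter Nat.Primrec.id, stdVal_letter Nat.Primrec.left, stdVal_letter Nat.Primrec.right,
      stdVal_letter Nat.Primrec.zero, id, ne_eq, Nat.cast_inj]
    intro a _
    by_cases h : a = 0
    · subst h
      exact Or.inr (by simp)
    · exact Or.inl h
  · simp only [tm, sat_all₂, sat_or, sat_and, sat_ne, sat_eq, sat_lt, cond_true, cond_false,
      stdVal_letter Nat.Primrec.id, stdVal_letter Nat.Primrec.left, stdVal_letter Nat.Primrec.right,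
      stdVal_letter Nat.Primrec.zero, stdVal_letter Nat.Primrec.succ,
      stdVal_letter (Nat.Primrec.succ.comp Nat.Primrec.left),
      stdVal_letter (Nat.Primrec.succ.comp Nat.Primrec.right), id, ne_eq, Nat.cast_inj,
      Nat.cast_lt]
    intro a b
    by_cases h : b = a.succ
    · subst h
      exact Or.inr (unpair_succ a)
    · exact Or.inl h

theorem represents_unpair {D : Type v} {V : ℕ → D → ℕ∞} {num : ℕ → ℕ∞} {e : Bool → D}
    (hN : Numbering V num) (h : unpairCon.Sat V e) :
    Represents V num (letter fun k => k.unpair.1) (fun k => k.unpair.1) ∧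
      Represents V num (letter fun k => k.unpair.2) (fun k => k.unpair.2) := by
  obtain ⟨⟨hSL, hSR⟩, h0, h1⟩ := h
  suffices H : ∀ k x, V (letter id) x = num k →
      V (letter fun k => k.unpair.1) x = num k.unpair.1 ∧
      V (letter fun k => k.unpair.2) x = num k.unpair.2 from
    ⟨fun x k hk => (H k x hk).1, fun x k hk => (H k x hk).2⟩
  have hZ : ∀ x, V (letter fun _ => 0) x = num 0 := hN.zero
  simp only [tm, sat_all₂, sat_or, sat_and, sat_ne, sat_eq, sat_lt, cond_true, cond_false, hZ]
    at h0 h1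
  intro k
  induction k with
  | zero =>
    intro x hx
    rcases h0 x x with h | h
    · exact absurd hx h
    · simpa using h
  | succ k ih =>
    intro y hy
    obtain ⟨x, hx⟩ := hN.exists_elem k
    obtain ⟨hL, hR⟩ := ih x hx
    have hSL' := comp_apply hN hSL hN.succ hL
    have hSR' := comp_apply hN hSR hN.succ hR
    have hinj := hN.strictMono.injective
    have hc := unpair_succ k
    have h := h1 x y
    rw [hL, hR, hSL', hSR', hN.strictMono.lt_iff_lt, hN.strictMono.lt_iff_lt, hinj.eq_iff,
      hinj.eq_iff] at h
    rcases h with h | ⟨h, h2, h3⟩ | ⟨h, h2, h3⟩ | ⟨h, h2, h3⟩ | ⟨h, h2, h3⟩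
    · exact absurd (hy.trans (hN.succ x k hx).symm) h
    all_goals
      rw [h2, h3]
      exact ⟨congrArg num (by omega), congrArg num (by omega)⟩

theorem definable_left : Definable.{v} fun k => k.unpair.1 :=
  ⟨unpairCon, sat_unpairCon_std, fun _ _ _ _ hN h => (represents_unpair hN h).1⟩

theorem definable_right : Definable.{v} fun k => k.unpair.2 :=
  ⟨unpairCon, sat_unpairCon_std, fun _ _ _ _ hN h => (represents_unpair hN h).2⟩

theorem Definable.pair {f g : ℕ → ℕ} (hf : Nat.Primrec f) (hg : Nat.Primrec g)
    (df : Definable.{v} f) (dg : Definable.{v} g) :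
    Definable.{v} fun k => Nat.pair (f k) (g k) := by
  obtain ⟨c, hc, hc'⟩ := df
  obtain ⟨d, hd, hd'⟩ := dg
  refine ⟨(c.and d).and (unpairCon.and (Con.pair f g _)),
    fun e => ⟨⟨hc e, hd e⟩, sat_unpairCon_std e, sat_pair_std hf hg (fun _ => rfl) e⟩, ?_⟩
  rintro D V num e hN ⟨⟨h1, h2⟩, h3, h4⟩ x k hk
  obtain ⟨hl, hr⟩ := represents_unpair hN h3
  exact pair_apply hN h4 hl hr (hc' D V num e hN h1 x k hk) (hd' D V num e hN h2 x k hk)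

theorem Definable.prec {f g : ℕ → ℕ} (hf : Nat.Primrec f) (hg : Nat.Primrec g)
    (df : Definable.{v} f) (dg : Definable.{v} g) :
    Definable.{v} (Nat.unpaired fun z n =>
      n.rec (f z) fun y IH => g (Nat.pair z (Nat.pair y IH))) := by
  have hh := hf.prec hg
  set h : ℕ → ℕ := Nat.unpaired fun z n =>
    n.rec (f z) fun y IH => g (Nat.pair z (Nat.pair y IH)) with h_def
  have h_zero : ∀ a, h (Nat.pair a 0) = f a := fun a => by simp [h_def, Nat.unpaired]
  have h_succ : ∀ a n, h (Nat.pair a (n + 1)) =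
      g (Nat.pair a (Nat.pair n (h (Nat.pair a n)))) := fun a n => by simp [h_def, Nat.unpaired]
  have hl := Nat.Primrec.left
  have hr := Nat.Primrec.right
  -- `fl` is the initial value, `p` increases the second component by one, and `q` is the value at
  -- `p k`, expressed through the value at `k`.
  obtain ⟨cf, hcf, hcf'⟩ := Definable.comp hf hl df definable_left
  obtain ⟨cp, hcp, hcp'⟩ := Definable.pair hl (Nat.Primrec.succ.comp hr) definable_left
    (Definable.comp Nat.Primrec.succ hr definable_succ definable_right)
  obtain ⟨cg, hcg, hcg'⟩ := dg
  have hfl := hf.comp hl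
  have hp := hl.pair (Nat.Primrec.succ.comp hr)
  have he1 := hr.pair hh
  have he2 := hl.pair he1
  have hq := hg.comp he2
  set fl : ℕ → ℕ := fun k => f k.unpair.1
  set p : ℕ → ℕ := fun k => Nat.pair k.unpair.1 k.unpair.2.succ with p_def
  set e1 : ℕ → ℕ := fun k => Nat.pair k.unpair.2 (h k) with e1_def
  set e2 : ℕ → ℕ := fun k => Nat.pair k.unpair.1 (e1 k) with e2_def
  set q : ℕ → ℕ := fun k => g (e2 k) with q_def
  refine ⟨((cf.and cp).and (cg.and unpairCon)).and <|
    ((Con.pair _ h e1).and ((Con.pair _ e1 e2).and (Con.comp g e2 q))).and <|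
    (all₂ (or (ne (tm (fun k => k.unpair.2) false) (tm (fun _ => 0) false))
      (eq (tm h false) (tm fl false)))).and <|
    all₂ (or (ne (tm id true) (tm p false)) (eq (tm h true) (tm q false))),
    fun e => ⟨⟨⟨hcf e, hcp e⟩, hcg e, sat_unpairCon_std e⟩,
      ⟨sat_pair_std hr hh (fun _ => rfl) e, sat_pair_std hl he1 (fun _ => rfl) e,
        sat_comp_std hg he2 (fun _ => rfl) e⟩, ?_, ?_⟩, ?_⟩
  · simp only [tm, sat_all₂, sat_or, sat_ne, sat_eq, cond_false, stdVal_letter hr,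
      stdVal_letter Nat.Primrec.zero, stdVal_letter hh, stdVal_letter hfl, ne_eq, Nat.cast_inj]
    intro a _
    by_cases h0 : a.unpair.2 = 0
    · right
      rw [← Nat.pair_unpair a, h0, h_zero]
      simp [fl]
    · exact Or.inl h0
  · simp only [tm, sat_all₂, sat_or, sat_ne, sat_eq, cond_false, cond_true, stdVal_letter hp,
      stdVal_letter Nat.Primrec.id, stdVal_letter hh, stdVal_letter hq, ne_eq, Nat.cast_inj, id]
    intro a b
    by_cases h0 : b = p a
    · right
      rw [h0, p_def, h_succ, q_def, e2_def, e1_def]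
      simp only [Nat.pair_unpair]
    · exact Or.inl h0
  · rintro D V num e hN ⟨⟨⟨h1, h2⟩, h3, h4⟩, ⟨h5, h6, h7⟩, h8, h9⟩
    have rfl₀ := hcf' D V num e hN h1
    have rp := hcp' D V num e hN h2
    have rg := hcg' D V num e hN h3
    obtain ⟨rl, rr⟩ := represents_unpair hN h4
    have hZ : ∀ x, V (letter fun _ => 0) x = num 0 := hN.zero
    simp only [tm, sat_all₂, sat_or, sat_ne, sat_eq, cond_false, cond_true, hZ] at h8 h9
    suffices H : ∀ n a x, V (letter id) x = num (Nat.pair a n) →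
        V (letter h) x = num (h (Nat.pair a n)) by
      intro x k hk
      have := H k.unpair.2 k.unpair.1 x
      rw [Nat.pair_unpair] at this
      exact this hk
    intro n a
    induction n with
    | zero =>
      intro x hx
      have hR := rr x _ hx
      simp only [Nat.unpair_pair] at hR
      rcases h8 x x with h | h
      · exact absurd hR h
      · rw [h, rfl₀ x _ hx, h_zero]
        simp [fl]
    | succ n ih =>
      intro y hy
      obtain ⟨x, hx⟩ := hN.exists_elem (Nat.pair a n)
      have hL := rl x _ hx
      have hR := rr x _ hx
      have hP := rp x _ hx
      simp only [p_def, Nat.unpair_pair] at hL hR hP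
      rcases h9 x y with h | h
      · exact absurd (hy.trans hP.symm) h
      · rw [h, comp_apply hN h7 rg
          (pair_apply hN h6 rl rr hL (pair_apply hN h5 rl rr hR (ih x hx))), h_succ]

/-- Every primitive recursive function is definable. -/
theorem definable_of_primrec {f : ℕ → ℕ} (hf : Nat.Primrec f) : Definable.{v} f := by
  induction hf with
  | zero => exact definable_zero
  | succ => exact definable_succ
  | left => exact definable_left
  | right => exact definable_right
  | pair hf hg df dg => exact df.pair hf hg dg
  | comp hf hg df dg => exact df.comp hf hg dg
  | prec hf hg df dg => exact df.prec hf hg dg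

/-! ### Numerals and the reduction -/

namespace Con

/-- The constraint that the variable `false` stands for the number `n`. The last quantifier returns
to the variable `false`, so that the recursion needs two variables only. -/
noncomputable def num : ℕ → Con
  | 0 => eq (tm id false) (tm (fun _ => 0) false)
  | n + 1 => ex true (and (eq (tm Nat.succ true) (tm id false))
      (ex false (and (eq (tm id false) (tm id true)) (num n))))

theorem sat_num_std (n : ℕ) : ∀ e : Bool → ℕ, e false = n → (num n).Sat stdVal e := by
  induction n with
  | zero =>
    intro e he
    simp [num, tm, stdVal_letter Nat.Primrec.id, stdVal_letter Nat.Primrec.zero, he]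
  | succ n ih =>
    intro e he
    refine ⟨n, ?_, n, ?_, ih _ (by simp)⟩
    · simp [tm, stdVal_letter Nat.Primrec.id, stdVal_letter Nat.Primrec.succ, he]
    · simp [tm]

theorem num_apply {D : Type v} {V : ℕ → D → ℕ∞} {ν : ℕ → ℕ∞} (hN : Numbering V ν) (n : ℕ) :
    ∀ e : Bool → D, (num n).Sat V e → V (letter id) (e false) = ν n := by
  induction n with
  | zero =>
    intro e h
    exact (sat_eq.1 h).trans (hN.zero _)
  | succ n ih =>
    rintro e ⟨y, hy, x, hx, h⟩
    have h1 := ih _ h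
    simp only [tm, sat_eq, Function.update_self, ne_eq, Bool.true_eq_false, Bool.false_eq_true,
      not_false_eq_true, Function.update_of_ne] at hy hx h1
    rw [← hy, hN.succ y n (hx.symm.trans h1)]

end Con

theorem primrec₂_and : Primrec₂ Formula.and := by
  refine Primrec.encode_iff.1 (?_ : Primrec fun p : Formula × Formula =>
    6 * Nat.pair (Encodable.encode p.1) (Encodable.encode p.2) + 1 + 1)
  exact Primrec.succ.comp (Primrec.succ.comp (Primrec.nat_mul.comp (Primrec.const 6)
    (Primrec₂.natPair.comp (Primrec.encode.comp Primrec.fst) (Primrec.encode.comp Primrec.snd))))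

theorem primrec₂_imp : Primrec₂ Formula.imp := by
  refine Primrec.encode_iff.1 (?_ : Primrec fun p : Formula × Formula =>
    6 * Nat.pair (Encodable.encode p.1) (Encodable.encode p.2) + 3 + 1)
  exact Primrec.succ.comp (Primrec.nat_add.comp (Primrec.nat_mul.comp (Primrec.const 6)
    (Primrec₂.natPair.comp (Primrec.encode.comp Primrec.fst) (Primrec.encode.comp Primrec.snd)))
    (Primrec.const 3))

theorem primrec_all (x : ℕ) : Primrec (Formula.all x) := by
  refine Primrec.encode_iff.1 (?_ : Primrec fun φ : Formula =>
    6 * Nat.pair x (Encodable.encode φ) + 4 + 1)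
  exact Primrec.succ.comp (Primrec.nat_add.comp (Primrec.nat_mul.comp (Primrec.const 6)
    (Primrec₂.natPair.comp (Primrec.const x) Primrec.encode)) (Primrec.const 4))

theorem primrec_ex (x : ℕ) : Primrec (Formula.ex x) := by
  refine Primrec.encode_iff.1 (?_ : Primrec fun φ : Formula =>
    6 * Nat.pair x (Encodable.encode φ) + 5 + 1)
  exact Primrec.succ.comp (Primrec.nat_add.comp (Primrec.nat_mul.comp (Primrec.const 6)
    (Primrec₂.natPair.comp (Primrec.const x) Primrec.encode)) (Primrec.const 5))

theorem primrec_num : Primrec fun n => (Con.num n).toFormula := by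
  have hstep : Primrec fun φ : Formula =>
      Formula.ex 1 (.and (Con.eq (tm Nat.succ true) (tm id false)).toFormula
        (.ex 0 (.and (Con.eq (tm id false) (tm id true)).toFormula φ))) :=
    (primrec_ex 1).comp (primrec₂_and.comp (Primrec.const _)
      ((primrec_ex 0).comp (primrec₂_and.comp (Primrec.const _) Primrec.id)))
  refine (Primrec.nat_rec₁ (Con.num 0).toFormula
    (hstep.comp₂ Primrec₂.right)).of_eq fun n => ?_
  induction n with
  | zero => rfl
  | succ n ih =>
    simp only at ih ⊢
    rw [ih]
    rfl

/-- The reduction: `tail` speaks about the number `n` that `false` stands for, using the letter of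
`g`. In the presence of the constraints that force a numbering in which the letter of `g` represents
`g`, it has to express that `n` is not in the set. -/
theorem reducesIn_of_tail {L : Set Formula} (hL : QSILe.{0, v} {natFrame} ⊆ L)
    (hL' : L ⊆ QSIL {natFrame.odot ℕ}) {A : ℕ → Prop} {g : ℕ → ℕ} (hg : Nat.Primrec g) (tail : Con)
    (hstd : ∀ e : Bool → ℕ, ¬ A (e false) → tail.Sat stdVal e)
    (htail : ∀ (D : Type v) (V : ℕ → D → ℕ∞) (ν : ℕ → ℕ∞) (e : Bool → D) (n : ℕ), Numbering V ν →
      Represents V ν (letter fun k => k.unpair.1) (fun k => k.unpair.1) →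
      Represents V ν (letter g) g → V (letter id) (e false) = ν n → tail.Sat V e → ¬ A n) :
    ReducesIn A (positiveFragment L) twoVarLang := by
  obtain ⟨c, hc, hc'⟩ := definable_of_primrec.{v} hg
  obtain ⟨d, hd, hd'⟩ := definable_left.{v}
  let con : ℕ → Con := fun n => (Con.base.and (c.and d)).and (.ex false ((Con.num n).and tail))
  refine ⟨fun n => .imp (Con.all₂ (con n)).toFormula Con.goal, ?_,
    fun n => Con.imp_goal_mem_twoVarLang _, fun n => ⟨fun hA => ⟨hL ?_, ?_⟩, fun hf => ?_⟩⟩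
  · refine Primrec.to_comp (primrec₂_imp.comp ((primrec_all 0).comp ((primrec_all 1).comp ?_))
      (Primrec.const _))
    exact primrec₂_and.comp (Primrec.const _) ((primrec_ex 0).comp
      (primrec₂_and.comp primrec_num (Primrec.const _)))
  · refine Con.mem_QSILe ?_
    rintro D V e ⟨⟨hb, hVc, hVd⟩, a, hn, ht⟩
    obtain ⟨ν, hN⟩ := Con.exists_numbering hb
    exact htail D V ν _ n hN (hd' D V ν e hN hVd) (hc' D V ν e hN hVc) (Con.num_apply hN n _ hn)
      ht hA
  · exact ⟨Con.isPositive _, trivial⟩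
  · by_contra hA
    refine Con.notMem_QSIL (fun e => ?_) (hL' hf.1)
    exact ⟨⟨Con.sat_base_std e, hc e, hd e⟩, n, Con.sat_num_std n _ (by simp),
      hstd _ (by simpa using hA)⟩

/-- A recursively enumerable set is the projection of the zero set of a primitive recursive
function, by bounding the number of computation steps. -/
theorem exists_primrec_of_rePred {A : ℕ → Prop} (hA : REPred A) :
    ∃ g, Nat.Primrec g ∧ ∀ n, A n ↔ ∃ m, m.unpair.1 = n ∧ g m = 0 := by
  obtain ⟨c, hc⟩ := Nat.Partrec.Code.exists_code.1 hA
  refine ⟨fun m => bif (Nat.Partrec.Code.evaln m.unpair.2 c m.unpair.1).isSome then 0 else 1,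
    Primrec.nat_iff.1 ?_, fun n => ?_⟩
  · refine Primrec.cond (Primrec.option_isSome.comp
      (Nat.Partrec.Code.primrec_evaln.comp (Primrec.pair (Primrec.pair
        (Primrec.snd.comp Primrec.unpair) (Primrec.const c)) (Primrec.fst.comp Primrec.unpair))))
      (Primrec.const 0) (Primrec.const 1)
  · have h1 : A n ↔ ∃ x, x ∈ c.eval n := by
      simp [hc]
    rw [h1]
    constructor
    · rintro ⟨x, hx⟩
      obtain ⟨k, hk⟩ := Nat.Partrec.Code.evaln_complete.1 hx
      exact ⟨Nat.pair n k, by simp, by simp [Option.mem_def.1 hk]⟩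
    · rintro ⟨m, rfl, hm⟩
      cases h : Nat.Partrec.Code.evaln m.unpair.2 c m.unpair.1 with
      | none => simp [h] at hm
      | some x => exact ⟨x, Nat.Partrec.Code.evaln_sound h⟩

theorem sigmaOneHardIn_positiveFragment {L : Set Formula} (hL : QSILe.{0, v} {natFrame} ⊆ L)
    (hL' : L ⊆ QSIL {natFrame.odot ℕ}) : SigmaOneHardIn (positiveFragment L) twoVarLang := by
  intro A hA
  obtain ⟨g, hg, hAg⟩ := exists_primrec_of_rePred hA
  -- `n` is outside of `A` if `g` has no zero `m` whose left component is `n`.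
  refine reducesIn_of_tail hL hL' hg (.all true (.or
    (ne (tm (fun k => k.unpair.1) true) (tm id false)) (.ne (tm g true) (tm (fun _ => 0) true))))
    ?_ ?_
  · intro e he m
    simp only [tm, sat_or, sat_ne, Function.update_self, ne_eq, Bool.false_eq_true,
      not_false_eq_true, Function.update_of_ne, stdVal_letter Nat.Primrec.left,
      stdVal_letter Nat.Primrec.id, stdVal_letter hg, stdVal_letter Nat.Primrec.zero, id,
      Nat.cast_inj]
    rw [hAg] at he
    by_contra! h
    exact he ⟨m, h⟩
  · intro D V ν e n hN hl hr hn ht hA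
    obtain ⟨m, rfl, hm⟩ := (hAg n).1 hA
    obtain ⟨y, hy⟩ := hN.exists_elem m
    have h := ht y
    simp only [tm, sat_or, sat_ne, Function.update_self, ne_eq, Bool.false_eq_true,
      not_false_eq_true, Function.update_of_ne] at h
    rcases h with h | h
    · exact h ((hl y m hy).trans hn.symm)
    · exact h ((hr y m hy).trans ((congrArg ν hm).trans (hN.zero y).symm))

theorem piOneHardIn_positiveFragment {L : Set Formula} (hL : QSILe.{0, v} {natFrame} ⊆ L)
    (hL' : L ⊆ QSIL {natFrame.odot ℕ}) : PiOneHardIn (positiveFragment L) twoVarLang := by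
  intro A hA
  obtain ⟨g, hg, hAg⟩ := exists_primrec_of_rePred hA
  -- `n` is outside of `A` if `g` has a zero `m` whose left component is `n`.
  refine reducesIn_of_tail hL hL' hg (.ex true (.and
    (eq (tm (fun k => k.unpair.1) true) (tm id false)) (.eq (tm g true) (tm (fun _ => 0) true))))
    ?_ ?_
  · intro e he
    obtain ⟨m, h⟩ := (hAg _).1 he
    refine ⟨m, ?_⟩
    simpa only [tm, sat_and, sat_eq, Function.update_self, ne_eq, Bool.false_eq_true,
      not_false_eq_true, Function.update_of_ne, stdVal_letter Nat.Primrec.left,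
      stdVal_letter Nat.Primrec.id, stdVal_letter hg, stdVal_letter Nat.Primrec.zero, id,
      Nat.cast_inj] using h
  · rintro D V ν e n hN hl hr hn ⟨y, ht⟩
    simp only [tm, sat_and, sat_eq, Function.update_self, ne_eq, Bool.false_eq_true,
      not_false_eq_true, Function.update_of_ne] at ht
    obtain ⟨m, hm⟩ := hN.exists_num y
    refine (hAg n).2 ⟨m, hN.strictMono.injective ?_, hN.strictMono.injective ?_⟩
    · rw [← hl y m hm, ht.1, hn]
    · rw [← hr y m hm, ht.2, ← hN.zero y, zeroLetter]

end IntPred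

theorem theorem5 (L : Set IntPred.Formula)
    (hL : IntPred.QSILe.{0, v} {IntPred.natFrame} ⊆ L)
    (hL' : L ⊆ IntPred.QSIL {IntPred.natFrame.odot ℕ}) :
    IntPred.SigmaOneHardIn (IntPred.positiveFragment L) IntPred.twoVarLang ∧
      IntPred.PiOneHardIn (IntPred.positiveFragment L) IntPred.twoVarLang :=
  ⟨IntPred.sigmaOneHardIn_positiveFragment hL hL', IntPred.piOneHardIn_positiveFragment hL hL'⟩
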